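/- Let $(X,\mu)$ be a $\sigma$-finite measure space with $\mu\neq 0$, and let $T\colon X\to X$ be an invertible (bimeasurable) transformation that is nonsingular (for measurable $A$, $\mu(A)=0$ if and only if $\mu(T(A))=0$) and conservative (for every measurable $A$ with $\mu(A)>0$ there are $x\in A$ and $m\ge 1$ with $T^m x\in A$). Let $\omega=\frac{d(\mu\circ T)}{d\mu}$ be the Radon–Nikodym derivative of the measure $A\mapsto\mu(T(A))$, taken with values in $(0,\infty)$. Let $X^*=X\times\mathbb R^+$, where $\mathbb R^+=(0,\infty)$, with the measure $\mu^*=\mu\times\lambda$, where $\lambda$ is Lebesgue measure, and let $T^*\colon X^*\to X^*$, $T^*(x,y)=(Tx,\,y/\omega(x))$, be the Maharam transformation of $T$. Then $T^*$ is an invertible measure-preserving transformation of $(X^*,\mu^*)$, and it is not rank-one. Here an invertible measure-preserving transformation $S$ of a measure space $(Y,\nu)$ is called rank-one if there are measurable sets $B_n\subset Y$ and integers $h_n\ge 1$ ($n\in\mathbb N$) such that, for each $n$, the sets $B_n,S(B_n),\dots,S^{h_n-1}(B_n)$ are pairwise disjoint, and such that for every measurable $A\subset Y$ with $\nu(A)<\infty$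 and every $\varepsilon>0$ there is an $N$ such that for all $n\ge N$ one has $\nu(A\,\triangle\, B_n')<\varepsilon$ for some union $B_n'$ of sets among $B_n,S(B_n),\dots,S^{h_n-1}(B_n)$. -/

import Mathlib

open MeasureTheory

noncomputable section

/-- An invertible bimeasurable map `T` is nonsingular if a measurable set is null exactly when
its image under `T` is null. -/
def IsNonsingular {X : Type*} [MeasurableSpace X] (T : X ≃ᵐ X) (μ : Measure X) : Prop :=
  ∀ A : Set X, MeasurableSet A → (μ A = 0 ↔ μ (T '' A) = 0)

/-- The sets `B, T B, …, T^(h-1) B` form a Rokhlin column of height `h ≥ 1`: they are measurable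
and pairwise disjoint. -/
structure IsColumn {Y : Type*} [MeasurableSpace Y] (T : Y ≃ᵐ Y) (B : Set Y) (h : ℕ) : Prop where
  height_pos : 0 < h
  measurableSet_base : MeasurableSet B
  disjoint_levels : ∀ i < h, ∀ j < h, i ≠ j → Disjoint (T^[i] '' B) (T^[j] '' B)

/-- Rank-one: an invertible measure-preserving transformation with a sequence of Rokhlin columns
such that every measurable set of finite measure is approximated arbitrarily well by unions of
levels of all sufficiently late columns. -/
def IsRankOne {Y : Type*} [MeasurableSpace Y] (T : Y ≃ᵐ Y) (ν : Measure Y) : Prop :=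
  MeasurePreserving T ν ν ∧
    ∃ (B : ℕ → Set Y) (h : ℕ → ℕ), (∀ n, IsColumn T (B n) (h n)) ∧
      ∀ A : Set Y, MeasurableSet A → ν A < ⊤ → ∀ ε : ENNReal, 0 < ε →
        ∃ N : ℕ, ∀ n ≥ N, ∃ E : Finset ℕ, E ⊆ Finset.range (h n) ∧
          ν (symmDiff A (⋃ i ∈ E, T^[i] '' B n)) < ε

/-- The Radon-Nikodym derivative `ω = d(μ ∘ T)/dμ`, where `(μ ∘ T) A = μ (T A)`, as a function
with values in `(0, ∞)`. For nonsingular `T` and σ-finite `μ` the derivative is positive and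
finite almost everywhere; on the remaining null set the value `1` is used. -/
def maharamDeriv {X : Type*} [MeasurableSpace X] (T : X ≃ᵐ X) (μ : Measure X) (x : X) : ℝ :=
  if 0 < ((μ.map T.symm).rnDeriv μ x).toReal then ((μ.map T.symm).rnDeriv μ x).toReal else 1

theorem maharamDeriv_pos {X : Type*} [MeasurableSpace X] (T : X ≃ᵐ X) (μ : Measure X) (x : X) :
    0 < maharamDeriv T μ x := by
  unfold maharamDeriv
  split_ifs with h
  · exact h
  · exact one_pos

theorem measurable_maharamDeriv {X : Type*} [MeasurableSpace X] (T : X ≃ᵐ X) (μ : Measure X) :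
    Measurable (maharamDeriv T μ) := by
  have h : Measurable fun x => ((μ.map T.symm).rnDeriv μ x).toReal :=
    (Measure.measurable_rnDeriv _ _).ennreal_toReal
  exact Measurable.ite (measurableSet_lt measurable_const h) h measurable_const

/-- The defining property of the Radon-Nikodym derivative. -/
theorem setLIntegral_maharamDeriv {X : Type*} [MeasurableSpace X] (T : X ≃ᵐ X) (μ : Measure X)
    [SigmaFinite μ] (hT : IsNonsingular T μ) (A : Set X) :
    ∫⁻ x in A, ENNReal.ofReal (maharamDeriv T μ x) ∂μ = μ (T '' A) := by
  have hmap : ∀ s : Set X, (μ.map T.symm) s = μ (T '' s) := fun s => by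
    rw [T.symm.map_apply, T.image_eq_preimage_symm]
  have : SigmaFinite (μ.map T.symm) := T.symm.sigmaFinite_map
  have h1 : μ.map T.symm ≪ μ := Measure.AbsolutelyContinuous.mk fun s hs h0 => by
    rw [hmap]; exact (hT s hs).1 h0
  have h2 : μ ≪ μ.map T.symm := Measure.AbsolutelyContinuous.mk fun s hs h0 => by
    rw [hmap] at h0; exact (hT s hs).2 h0
  have hae : (fun x => ENNReal.ofReal (maharamDeriv T μ x)) =ᵐ[μ] (μ.map T.symm).rnDeriv μ := by
    filter_upwards [Measure.rnDeriv_lt_top (μ.map T.symm) μ, Measure.rnDeriv_pos' h2] with x hx hx'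
    rw [maharamDeriv, if_pos (ENNReal.toReal_pos hx'.ne' hx.ne), ENNReal.ofReal_toReal hx.ne]
  rw [lintegral_congr_ae (ae_restrict_of_ae hae), Measure.setLIntegral_rnDeriv h1, hmap]

/-- The measure `μ* = μ × λ` on `X* = X × (0, ∞)`, with `λ` Lebesgue measure. -/
def maharamMeasure {X : Type*} [MeasurableSpace X] (μ : Measure X) :
    Measure (X × Set.Ioi (0 : ℝ)) :=
  μ.prod (Measure.comap Subtype.val volume)

/-- The Maharam transformation `T*(x, y) = (T x, y / ω x)` on `X × (0, ∞)`, with its inverse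
`(x, y) ↦ (T⁻¹ x, y * ω (T⁻¹ x))`. -/
def maharam {X : Type*} [MeasurableSpace X] (T : X ≃ᵐ X) (μ : Measure X) :
    (X × Set.Ioi (0 : ℝ)) ≃ᵐ (X × Set.Ioi (0 : ℝ)) where
  toFun p := (T p.1, ⟨p.2 / maharamDeriv T μ p.1, div_pos p.2.2 (maharamDeriv_pos T μ p.1)⟩)
  invFun p := (T.symm p.1, ⟨p.2 * maharamDeriv T μ (T.symm p.1),
    mul_pos p.2.2 (maharamDeriv_pos T μ (T.symm p.1))⟩)
  left_inv p := by
    have h := (maharamDeriv_pos T μ p.1).ne'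
    refine Prod.ext (by simp) (Subtype.ext ?_)
    simp [h]
  right_inv p := by
    have h := (maharamDeriv_pos T μ (T.symm p.1)).ne'
    refine Prod.ext (by simp) (Subtype.ext ?_)
    simp [h]
  measurable_toFun := by
    have hm := measurable_maharamDeriv T μ
    refine (T.measurable.comp measurable_fst).prodMk (Measurable.subtype_mk ?_)
    exact (measurable_subtype_coe.comp measurable_snd).div (hm.comp measurable_fst)
  measurable_invFun := by
    have hm := measurable_maharamDeriv T μ
    refine (T.symm.measurable.comp measurable_fst).prodMk (Measurable.subtype_mk ?_)
    exact (measurable_subtype_coe.comp measurable_snd).mul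
      (hm.comp (T.symm.measurable.comp measurable_fst))

end

open scoped ENNReal

/-! ### Columns and measure-scaling symmetries. -/

section Column

variable {Y : Type*} [MeasurableSpace Y]

/-! The fibre dilation `S (x, y) = (x, 3y)` commutes with the Maharam transformation and triples the
measure; no rank-one map admits such a symmetry. Approximate `A` and `S '' A` by unions `U`, `V` of
levels of one column with base `B`. Then `S '' U` is a union of levels of the column over `S '' B`,
and each of its levels meets the column over `B` in measure at most `2 * ν B`
(`IsColumn.sum_measure_level_inter_le`). Hence `S '' U ∩ V`, which is close to `S '' A`, has measure
at most `2 * ν U`, roughly `2 * ν A` rather than `3 * ν A`. -/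

theorem MeasurableEquiv.measurableEmbedding_iterate (T : Y ≃ᵐ Y) (n : ℕ) :
    MeasurableEmbedding T^[n] := by
  induction n with
  | zero => exact MeasurableEmbedding.id
  | succ n ih =>
    rw [Function.iterate_succ]
    exact ih.comp T.measurableEmbedding

theorem MeasureTheory.MeasurePreserving.measure_iterate_image {T : Y ≃ᵐ Y} {ν : Measure Y}
    (hT : MeasurePreserving T ν ν) (n : ℕ) (B : Set Y) : ν (T^[n] '' B) = ν B := by
  have hemb := T.measurableEmbedding_iterate n
  rw [← (hT.iterate n).measure_preimage_emb hemb, Set.preimage_image_eq _ hemb.injective]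

/-- An invertible map commuting with `T` sends columns to columns. -/
theorem IsColumn.image {T S : Y ≃ᵐ Y} (hST : Function.Commute S T) {B : Set Y} {h : ℕ}
    (hB : IsColumn T B h) : IsColumn T (S '' B) h where
  height_pos := hB.height_pos
  measurableSet_base := S.measurableSet_image.2 hB.measurableSet_base
  disjoint_levels i hi j hj hij := by
    have key : ∀ k, T^[k] '' (S '' B) = S '' (T^[k] '' B) := fun k => by
      simp only [← Set.image_comp, (hST.iterate_right k).comp_eq]
    rw [key, key]
    exact (Set.disjoint_image_iff S.injective).2 (hB.disjoint_levels i hi j hj hij)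

theorem IsColumn.measurableSet_level {T : Y ≃ᵐ Y} {B : Set Y} {h : ℕ} (hB : IsColumn T B h)
    (i : ℕ) : MeasurableSet (T^[i] '' B) :=
  (T.measurableEmbedding_iterate i).measurableSet_image.2 hB.measurableSet_base

/-- The traces of `h` consecutive iterates of the base on a set are disjoint. -/
theorem IsColumn.sum_measure_inter_le {T : Y ≃ᵐ Y} {ν : Measure Y} {B : Set Y} {h : ℕ}
    (hB : IsColumn T B h) (k : ℕ) {G : Set Y} (hG : MeasurableSet G) :
    ∑ m ∈ Finset.range h, ν (T^[k + m] '' B ∩ G) ≤ ν G := by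
  rw [← measure_biUnion_finset]
  · exact measure_mono (Set.iUnion₂_subset fun _ _ => Set.inter_subset_right)
  · intro i hi j hj hij
    refine Disjoint.mono Set.inter_subset_left Set.inter_subset_left ?_
    simp only [Function.iterate_add, Set.image_comp]
    exact (Set.disjoint_image_iff (T.injective.iterate k)).2
      (hB.disjoint_levels i (by simpa using hi) j (by simpa using hj) hij)
  · exact fun m _ => (hB.measurableSet_level _).inter hG

theorem IsColumn.measure_biUnion {T : Y ≃ᵐ Y} {ν : Measure Y} (hT : MeasurePreserving T ν ν)
    {B : Set Y} {h : ℕ} (hB : IsColumn T B h) {E : Finset ℕ} (hE : E ⊆ Finset.range h) :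
    ν (⋃ i ∈ E, T^[i] '' B) = E.card * ν B := by
  rw [measure_biUnion_finset]
  · simp [hT.measure_iterate_image]
  · intro i hi j hj hij
    exact hB.disjoint_levels i (by simpa using hE hi) j (by simpa using hE hj) hij
  · exact fun i _ => hB.measurableSet_level i

/-- A level of one column meets the levels of another column of the same height in measure at
most twice that of a level of the latter. -/
theorem IsColumn.sum_measure_level_inter_le {T : Y ≃ᵐ Y} {ν : Measure Y}
    (hT : MeasurePreserving T ν ν) {B C : Set Y} {h : ℕ} (hB : IsColumn T B h)
    (hC : IsColumn T C h) (e : ℕ) (he : e < h) :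
    ∑ f ∈ Finset.range h, ν (T^[e] '' C ∩ T^[f] '' B) ≤ 2 * ν B := by
  -- Applying `T^[h - f]` carries every level of `B` to the same set `T^[h] '' B`. The exponents `h
  -- + e - f` are distinct and lie below `2 * h`.
  have hshift : ∀ f ∈ Finset.range h, ν (T^[e] '' C ∩ T^[f] '' B) =
      ν (T^[h + e - f] '' C ∩ T^[h] '' B) := fun f hf => by
    have hf' : f < h := by simpa using hf
    rw [← hT.measure_iterate_image (h - f),
      Set.image_inter (T.injective.iterate _), ← Set.image_comp, ← Set.image_comp,
      ← Function.iterate_add, ← Function.iterate_add, Nat.sub_add_cancel hf'.le,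
      ← Nat.sub_add_comm hf'.le]
  rw [Finset.sum_congr rfl hshift]
  have hinj : Set.InjOn (fun f => h + e - f) (Finset.range h : Set ℕ) := fun i hi j hj hij => by
    simp only [Finset.coe_range, Set.mem_Iio] at hi hj hij
    omega
  rw [← Finset.sum_image (f := fun m => ν (T^[m] '' C ∩ T^[h] '' B)) hinj]
  calc _ ≤ ∑ m ∈ Finset.range (h + h), ν (T^[m] '' C ∩ T^[h] '' B) := by
        refine Finset.sum_le_sum_of_subset fun m hm => ?_
        simp only [Finset.mem_image, Finset.mem_range] at hm ⊢
        omega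
    _ ≤ ν (T^[h] '' B) + ν (T^[h] '' B) := by
        -- Two blocks of `h` consecutive iterates of `C`, each disjoint within itself: this is the
        -- source of the factor 2.
        rw [Finset.sum_range_add]
        refine add_le_add ?_ (hC.sum_measure_inter_le h (hB.measurableSet_level h))
        simpa using hC.sum_measure_inter_le 0 (hB.measurableSet_level h)
    _ = 2 * ν B := by rw [hT.measure_iterate_image, two_mul]

/-- The bound involves `ν B` and not `ν C`, so it gains when `C` is much larger than `B`. -/
theorem IsColumn.measure_biUnion_inter_biUnion_le {T : Y ≃ᵐ Y} {ν : Measure Y}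
    (hT : MeasurePreserving T ν ν) {B C : Set Y} {h : ℕ} (hB : IsColumn T B h)
    (hC : IsColumn T C h) {E F : Finset ℕ} (hE : E ⊆ Finset.range h)
    (hF : F ⊆ Finset.range h) :
    ν ((⋃ e ∈ E, T^[e] '' C) ∩ ⋃ f ∈ F, T^[f] '' B) ≤ 2 * (E.card * ν B) := by
  calc _ ≤ ν (⋃ e ∈ E, ⋃ f ∈ F, T^[e] '' C ∩ T^[f] '' B) := by
        refine measure_mono ?_
        rw [Set.iUnion₂_inter]
        simp only [Set.inter_iUnion₂, subset_refl]
    _ ≤ ∑ e ∈ E, ∑ f ∈ F, ν (T^[e] '' C ∩ T^[f] '' B) :=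
        (measure_biUnion_finset_le _ _).trans
          (Finset.sum_le_sum fun _ _ => measure_biUnion_finset_le _ _)
    _ ≤ ∑ e ∈ E, 2 * ν B := Finset.sum_le_sum fun e he =>
        (Finset.sum_le_sum_of_subset hF).trans
          (hB.sum_measure_level_inter_le hT hC e (by simpa using hE he))
    _ = 2 * (E.card * ν B) := by
        rw [Finset.sum_const, nsmul_eq_mul]; ring

/-- A rank-one transformation does not commute with an invertible transformation that triples
the measure. -/
theorem IsRankOne.false_of_commute {T S : Y ≃ᵐ Y} {ν : Measure Y} (hR : IsRankOne T ν)
    (hST : Function.Commute S T) (hS : ∀ A, MeasurableSet A → ν (S '' A) = 3 * ν A)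
    {A : Set Y} (hA : MeasurableSet A) (h0 : ν A ≠ 0) (htop : ν A ≠ ⊤) : False := by
  obtain ⟨hT, B, h, hB, happ⟩ := hR
  -- The final estimate reads `3 * ν A ≤ 2 * ν A + 6 * ε`, so any positive `ε` below `ν A / 6` would
  -- do.
  obtain ⟨ε, hε_def⟩ : ∃ ε : ℝ≥0∞, ε = ν A / 7 := ⟨_, rfl⟩
  have hε : 0 < ε := hε_def ▸ ENNReal.div_pos h0 (by simp)
  have hSA := S.measurableSet_image.2 hA
  obtain ⟨N₁, h₁⟩ := happ A hA htop.lt_top ε hε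
  obtain ⟨N₂, h₂⟩ := happ (S '' A) hSA
    (by rw [hS A hA]; exact ENNReal.mul_lt_top (by simp) htop.lt_top) ε hε
  obtain ⟨E, hE, hEA⟩ := h₁ (max N₁ N₂) (le_max_left _ _)
  obtain ⟨F, hF, hFA⟩ := h₂ (max N₁ N₂) (le_max_right _ _)
  generalize max N₁ N₂ = n at hE hF hEA hFA
  set U := ⋃ i ∈ E, T^[i] '' B n
  set V := ⋃ i ∈ F, T^[i] '' B n
  have hU : MeasurableSet U := E.measurableSet_biUnion fun i _ => (hB n).measurableSet_level i
  have hSU : S '' U = ⋃ i ∈ E, T^[i] '' (S '' B n) := by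
    simp only [U, Set.image_iUnion, ← Set.image_comp, (hST.iterate_right _).comp_eq]
  have hcard : E.card * ν (B n) ≤ ν A + ε := by
    rw [← (hB n).measure_biUnion hT hE]
    calc ν U ≤ ν (A ∪ symmDiff A U) := measure_mono fun x hx => by
          by_cases hxA : x ∈ A
          · exact Or.inl hxA
          · exact Or.inr (Or.inr ⟨hx, hxA⟩)
      _ ≤ ν A + ε := (measure_union_le _ _).trans (add_le_add le_rfl hEA.le)
  have hinter : ν (S '' U ∩ V) ≤ 2 * (ν A + ε) := by
    rw [hSU]
    exact ((hB n).measure_biUnion_inter_biUnion_le hT ((hB n).image hST) hE hF).trans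
      (mul_le_mul_right hcard 2)
  have hmain : 3 * ν A ≤ 2 * (ν A + ε) + 3 * ε + ε := by
    calc 3 * ν A = ν (S '' A) := (hS A hA).symm
      _ ≤ ν ((S '' U ∩ V ∪ S '' symmDiff A U) ∪ symmDiff (S '' A) V) :=
        measure_mono fun x hx => by
          by_cases hV : x ∈ V
          · obtain ⟨a, ha, rfl⟩ := hx
            by_cases haU : a ∈ U
            · exact Or.inl (Or.inl ⟨⟨a, haU, rfl⟩, hV⟩)
            · exact Or.inl (Or.inr ⟨a, Or.inl ⟨ha, haU⟩, rfl⟩)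
          · exact Or.inr (Or.inl ⟨hx, hV⟩)
      _ ≤ ν (S '' U ∩ V) + ν (S '' symmDiff A U) + ν (symmDiff (S '' A) V) :=
        (measure_union_le _ _).trans (add_le_add (measure_union_le _ _) le_rfl)
      _ ≤ 2 * (ν A + ε) + 3 * ε + ε := by
        rw [hS _ (hA.symmDiff hU)]
        gcongr
  have hεtop : ε ≠ ⊤ := hε_def ▸ ENNReal.div_ne_top htop (by simp)
  have h7 : ν A = 7 * ε := by rw [hε_def, ENNReal.mul_div_cancel (by simp) (by simp)]
  rw [h7] at hmain
  lift ε to NNReal using hεtop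
  have hpos : 0 < ε := by exact_mod_cast hε
  have : 3 * (7 * ε) ≤ 2 * (7 * ε + ε) + 3 * ε + ε := by exact_mod_cast hmain
  have : (3 * (7 * ε) : ℝ) ≤ 2 * (7 * ε + ε) + 3 * ε + ε := by exact_mod_cast this
  have : (0 : ℝ) < ε := by exact_mod_cast hpos
  linarith

end Column

/-! ### The Maharam transformation and its fibre dilations. -/

section Maharam

variable {X : Type*} [MeasurableSpace X]

theorem Real.comap_volume_preimage_div {w : ℝ} (hw : 0 < w) (s : Set (Set.Ioi (0 : ℝ))) :
    Measure.comap Subtype.val volume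
      ((fun y : Set.Ioi (0 : ℝ) => (⟨y / w, div_pos y.2 hw⟩ : Set.Ioi (0 : ℝ))) ⁻¹' s) =
      ENNReal.ofReal w * Measure.comap Subtype.val volume s := by
  have hemb := MeasurableEmbedding.subtype_coe (measurableSet_Ioi (a := (0 : ℝ)))
  rw [hemb.comap_apply, hemb.comap_apply]
  have : (Subtype.val '' ((fun y : Set.Ioi (0 : ℝ) =>
      (⟨y / w, div_pos y.2 hw⟩ : Set.Ioi (0 : ℝ))) ⁻¹' s)) =
      (fun y : ℝ => y * w⁻¹) ⁻¹' (Subtype.val '' s) := by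
    ext y
    simp only [Set.mem_image, Set.mem_preimage, Subtype.exists, exists_and_right, exists_eq_right,
      Set.mem_Ioi, div_eq_mul_inv]
    exact ⟨fun ⟨h0, h⟩ => ⟨mul_pos h0 (inv_pos.2 hw), h⟩, fun ⟨h0, h⟩ => ⟨pos_of_mul_pos_left h0 (inv_pos.2 hw).le, h⟩⟩
  rw [this, Real.volume_preimage_mul_right (inv_ne_zero hw.ne'), inv_inv, abs_of_pos hw]

instance : SigmaFinite (Measure.comap (Subtype.val : Set.Ioi (0 : ℝ) → ℝ) volume) :=
  SigmaFinite.of_map _ measurable_subtype_coe.aemeasurable <| by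
    rw [(MeasurableEmbedding.subtype_coe measurableSet_Ioi).map_comap]
    infer_instance

/-- Change of variables: the density `ω` turns `μ` into its image under `T.symm`. -/
theorem lintegral_comp_mul_maharamDeriv (T : X ≃ᵐ X) (μ : Measure X) [SigmaFinite μ]
    (hT : IsNonsingular T μ) {g : X → ℝ≥0∞} (hg : Measurable g) :
    ∫⁻ x, ENNReal.ofReal (maharamDeriv T μ x) * g (T x) ∂μ = ∫⁻ x, g x ∂μ := by
  have hd : μ.withDensity (fun x => ENNReal.ofReal (maharamDeriv T μ x)) = μ.map T.symm := by
    ext s hs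
    rw [withDensity_apply _ hs, setLIntegral_maharamDeriv T μ hT, T.symm.map_apply,
      T.image_eq_preimage_symm]
  calc _ = ∫⁻ x, g (T x) ∂(μ.withDensity fun x => ENNReal.ofReal (maharamDeriv T μ x)) :=
        (lintegral_withDensity_eq_lintegral_mul _
          (measurable_maharamDeriv T μ).ennreal_ofReal (hg.comp T.measurable)).symm
    _ = ∫⁻ x, g x ∂μ := by
        rw [hd, lintegral_map_equiv]
        simp

/-- By Tonelli: the fibre of the preimage over `x` is the fibre over `T x` dilated by `ω x`, and
this factor is absorbed by the change of variables on the base. -/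
theorem measurePreserving_maharam (T : X ≃ᵐ X) (μ : Measure X) [SigmaFinite μ]
    (hT : IsNonsingular T μ) :
    MeasurePreserving (maharam T μ) (maharamMeasure μ) (maharamMeasure μ) := by
  refine ⟨(maharam T μ).measurable, Measure.ext fun A hA => ?_⟩
  rw [(maharam T μ).map_apply, maharamMeasure,
    Measure.prod_apply ((maharam T μ).measurable hA), Measure.prod_apply hA,
    ← lintegral_comp_mul_maharamDeriv T μ hT (measurable_measure_prodMk_left hA)]
  exact lintegral_congr fun x => Real.comap_volume_preimage_div (maharamDeriv_pos T μ x)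
    (Prod.mk (T x) ⁻¹' A)

/-- The map `(x, y) ↦ (x, c * y)` on `X × (0, ∞)`. -/
noncomputable def fiberScaling (X : Type*) [MeasurableSpace X] (c : ℝ) (hc : 0 < c) :
    (X × Set.Ioi (0 : ℝ)) ≃ᵐ (X × Set.Ioi (0 : ℝ)) where
  toFun p := (p.1, ⟨p.2 * c, mul_pos p.2.2 hc⟩)
  invFun p := (p.1, ⟨p.2 / c, div_pos p.2.2 hc⟩)
  left_inv p := Prod.ext rfl (Subtype.ext (by simp [hc.ne']))
  right_inv p := Prod.ext rfl (Subtype.ext (by simp [hc.ne']))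
  measurable_toFun := measurable_fst.prodMk
    (((measurable_subtype_coe.comp measurable_snd).mul_const c).subtype_mk)
  measurable_invFun := measurable_fst.prodMk
    (((measurable_subtype_coe.comp measurable_snd).div_const c).subtype_mk)

theorem maharamMeasure_fiberScaling_image (μ : Measure X) {c : ℝ} (hc : 0 < c)
    {A : Set (X × Set.Ioi (0 : ℝ))} (hA : MeasurableSet A) :
    maharamMeasure μ (fiberScaling X c hc '' A) = ENNReal.ofReal c * maharamMeasure μ A := by
  rw [MeasurableEquiv.image_eq_preimage_symm, maharamMeasure,
    Measure.prod_apply ((fiberScaling X c hc).symm.measurable hA), Measure.prod_apply hA,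
    ← lintegral_const_mul _ (measurable_measure_prodMk_left hA)]
  exact lintegral_congr fun x => Real.comap_volume_preimage_div hc (Prod.mk x ⁻¹' A)

theorem commute_fiberScaling_maharam (T : X ≃ᵐ X) (μ : Measure X) {c : ℝ} (hc : 0 < c) :
    Function.Commute (fiberScaling X c hc) (maharam T μ) := fun p =>
  Prod.ext rfl (Subtype.ext (div_mul_eq_mul_div (p.2 : ℝ) (maharamDeriv T μ p.1) c))

theorem maharamMeasure_ne_zero {μ : Measure X} (hμ : μ ≠ 0) :
    maharamMeasure μ ≠ 0 := by
  intro h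
  have h1 : maharamMeasure μ Set.univ = 0 := by rw [h]; rfl
  rw [maharamMeasure, ← Set.univ_prod_univ, Measure.prod_prod, mul_eq_zero] at h1
  rcases h1 with h1 | h1
  · exact hμ (Measure.measure_univ_eq_zero.1 h1)
  · rw [(MeasurableEmbedding.subtype_coe measurableSet_Ioi).comap_apply] at h1
    rw [Set.image_univ, Subtype.range_coe, Real.volume_Ioi] at h1
    exact ENNReal.top_ne_zero h1

end Maharam

theorem mainTheorem7 {X : Type*} [MeasurableSpace X] (μ : Measure X) [SigmaFinite μ]
    (hμ : μ ≠ 0) (T : X ≃ᵐ X) (hT : IsNonsingular T μ) (hc : Conservative T μ) :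
    MeasurePreserving (maharam T μ) (maharamMeasure μ) (maharamMeasure μ) ∧
      ¬ IsRankOne (maharam T μ) (maharamMeasure μ) := by
  refine ⟨measurePreserving_maharam T μ hT, fun hR => ?_⟩
  have : SigmaFinite (maharamMeasure μ) := by unfold maharamMeasure; infer_instance
  obtain ⟨A, hA, -, h0, htop⟩ := Measure.exists_subset_measure_lt_top (μ := maharamMeasure μ)
    (s := Set.univ) (r := 0) MeasurableSet.univ
    (pos_iff_ne_zero.2 fun h => maharamMeasure_ne_zero hμ (Measure.measure_univ_eq_zero.1 h))
  -- Dilating by 3 exceeds the factor 2 in the overlap bound.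
  refine hR.false_of_commute (commute_fiberScaling_maharam T μ (c := 3) three_pos)
    (fun A hA => ?_) hA h0.ne' htop.ne
  rw [maharamMeasure_fiberScaling_image μ three_pos hA]
  norm_num
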